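/- Let $\Lambda=(-1,1)$ and let $s>0$ be real. For a tempered distribution $u$ on $\mathbb{R}$ with Fourier transform $\widehat u(\xi)=\int_{\mathbb{R}}u(x)e^{-\mathrm{i}\xi x}\,dx$, put $$\|u\|_{s,\mathbb{R}}=\Big(\frac1{2\pi}\int_{\mathbb{R}}(1+|\xi|^2)^s|\widehat u(\xi)|^2\,d\xi\Big)^{1/2},$$ and let $H^s(\mathbb{R})$ be the space of those complex-valued $u$ for which $\widehat u$ is a function and $\|u\|_{s,\mathbb{R}}<\infty$. For a distribution $v$ on $\Lambda$, let $\tilde v$ denote its extension by zero to $\mathbb{R}$ (so $\tilde v|_\Lambda=v$ and $\tilde v=0$ on $\mathbb{R}\setminus\Lambda$). Let $$H^s_*(\Lambda)=\{v\in\mathscr{D}'(\Lambda):\ \tilde v\in H^s(\mathbb{R})\},\qquad \|v\|_{s,*}=\|\tilde v\|_{s,\mathbb{R}}.$$ **Theorem.** For every $s>0$, $H^s_*(\Lambda)$ is compactly embedded in $L^2(\Lambda)$: every $v\in H^s_*(\Lambda)$ is (represented by) a function in $L^2(\Lambda)$, and the resulting injective linear map $H^s_*(\Lambda)\to L^2(\Lambda)$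 is continuous and compact. -/

import Mathlib

open MeasureTheory TopologicalSpace TemperedDistribution FourierTransform
open scoped Distributions SchwartzMap NNReal ENNReal ContDiff

noncomputable section

namespace FracSobolev

/-! ### The space `H^s(ℝ)` -/

/-- The weight `(1 + |ξ|²)^{s/2}` at the angular frequency `ξ = 2πη`.  (Mathlib's Fourier transform
is `𝓕 u (η) = ∫ u(x) e^{-2πiηx} dx`, that is `û(2πη)` for `û(ξ) = ∫ u(x) e^{-iξx} dx`.) -/
def weight (s η : ℝ) : ℝ := (1 + (2 * Real.pi * η) ^ 2) ^ (s / 2)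

theorem weight_hasTemperateGrowth (s : ℝ) :
    (fun η : ℝ => (weight s η : ℂ)).HasTemperateGrowth := by
  have h1 : (fun η : ℝ => (1 + ‖η‖ ^ 2) ^ (s / 2)).HasTemperateGrowth := by fun_prop
  have h2 : (fun η : ℝ => 2 * Real.pi * η).HasTemperateGrowth := by fun_prop
  have h3 : (fun η : ℝ => weight s η).HasTemperateGrowth := by
    convert h1.comp h2 using 2 with η
    simp [weight]
  fun_prop

theorem weight_neg_mul (s η : ℝ) : weight (-s) η * weight s η = 1 := by
  have h : 0 < 1 + (2 * Real.pi * η) ^ 2 := by positivity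
  rw [weight, weight, ← Real.rpow_add h]
  simp [neg_div]

/-- The tempered distribution `(1 + |ξ|²)^{s/2} û`, written in the variable `η = ξ / 2π`. -/
def weightedFourier (s : ℝ) : 𝓢'(ℝ, ℂ) →ₗ[ℂ] 𝓢'(ℝ, ℂ) where
  toFun u := smulLeftCLM ℂ (fun η : ℝ => (weight s η : ℂ)) (𝓕 u)
  map_add' u v := by simp [FourierTransform.fourier_add]
  map_smul' c u := by simp [FourierTransform.fourier_smul]

/-- `H^s(ℝ)`: the tempered distributions `u` for which `(1 + |ξ|²)^{s/2} û` is a function in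
`L²(ℝ)`. -/
def sobolev (s : ℝ) : Submodule ℂ 𝓢'(ℝ, ℂ) :=
  (LinearMap.range (Lp.toTemperedDistributionCLM ℂ (volume : Measure ℝ) 2).toLinearMap).comap
    (weightedFourier s)

theorem toTemperedDistribution_injective :
    Function.Injective (Lp.toTemperedDistributionCLM ℂ (volume : Measure ℝ) 2).toLinearMap :=
  LinearMap.ker_eq_bot.mp Lp.ker_toTemperedDistributionCLM_eq_bot

/-- For `u ∈ H^s(ℝ)`, the function `(1 + |ξ|²)^{s/2} û` as an element of `L²(ℝ)`
(in the variable `η = ξ / 2π`). -/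
def density (s : ℝ) : sobolev s →ₗ[ℂ] Lp ℂ 2 (volume : Measure ℝ) :=
  (LinearEquiv.ofInjective _ toTemperedDistribution_injective).symm.toLinearMap ∘ₗ
    ((weightedFourier s).restrict (fun _ hu => hu))

theorem density_spec (s : ℝ) (u : sobolev s) :
    (density s u : 𝓢'(ℝ, ℂ)) = weightedFourier s u := by
  have h := LinearEquiv.apply_symm_apply
    (LinearEquiv.ofInjective _ toTemperedDistribution_injective)
    ((weightedFourier s).restrict (fun _ hu => hu) u :
      LinearMap.range (Lp.toTemperedDistributionCLM ℂ (volume : Measure ℝ) 2).toLinearMap)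
  exact congrArg Subtype.val h

/-- The norm `‖u‖_{s,ℝ} = (1/2π ∫ (1 + |ξ|²)^s |û(ξ)|² dξ)^{1/2}` of `H^s(ℝ)`, which is
`(∫ (1 + |2πη|²)^s |𝓕 u (η)|² dη)^{1/2}` in the variable `η = ξ / 2π`. -/
def sobolevNorm (s : ℝ) (u : sobolev s) : ℝ := ‖density s u‖

theorem smulLeft_weight_neg (s : ℝ) (u : 𝓢'(ℝ, ℂ)) :
    smulLeftCLM ℂ (fun η : ℝ => (weight (-s) η : ℂ)) (weightedFourier s u) = 𝓕 u := by
  change smulLeftCLM ℂ _ (smulLeftCLM ℂ _ (𝓕 u)) = _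
  rw [smulLeftCLM_smulLeftCLM_apply (weight_hasTemperateGrowth _) (weight_hasTemperateGrowth _)]
  have : ((fun η : ℝ => (weight s η : ℂ)) * fun η : ℝ => (weight (-s) η : ℂ)) = fun _ => 1 := by
    ext η
    rw [Pi.mul_apply, mul_comm]
    exact_mod_cast weight_neg_mul s η
  rw [this]
  simp

theorem density_injective (s : ℝ) : Function.Injective (density s) := by
  refine (injective_iff_map_eq_zero _).mpr fun u hu => ?_
  have h := density_spec s u
  rw [hu, ← Lp.toTemperedDistributionCLM_apply, map_zero] at h
  have h2 := smulLeft_weight_neg s u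
  rw [← h, map_zero] at h2
  have h3 : 𝓕⁻ (𝓕 (u : 𝓢'(ℝ, ℂ))) = u := FourierTransform.fourierInv_fourier_eq _
  rw [← h2] at h3
  ext1
  rw [← h3]
  exact (FourierTransform.fourierInvCLM ℂ 𝓢'(ℝ, ℂ)).map_zero

/-- For `s ≥ 0`, the elements of `H^s(ℝ)` are functions in `L²(ℝ)`. -/
theorem exists_L2_of_mem_sobolev (s : ℝ≥0) {u : 𝓢'(ℝ, ℂ)} (hu : u ∈ sobolev s) :
    ∃ f : Lp ℂ 2 (volume : Measure ℝ), (f : 𝓢'(ℝ, ℂ)) = u := by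
  have hmem : MemLp (fun η : ℝ => (weight (-s) η : ℂ)) ⊤ (volume : Measure ℝ) := by
    refine memLp_top_of_bound
      (weight_hasTemperateGrowth _).1.continuous.aestronglyMeasurable 1 (.of_forall fun η => ?_)
    have h1 : 0 ≤ weight (-s) η := by unfold weight; positivity
    rw [Complex.norm_real, Real.norm_of_nonneg h1]
    refine Real.rpow_le_one_of_one_le_of_nonpos (by nlinarith [sq_nonneg (2 * Real.pi * η)]) ?_
    have := s.2
    simp only [NNReal.val_eq_coe] at this
    linarith
  let g := density s ⟨u, hu⟩
  let k : Lp ℂ 2 (volume : Measure ℝ) := hmem.toLp _ • g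
  have hk : (k : 𝓢'(ℝ, ℂ)) = 𝓕 u := by
    rw [Lp.toTemperedDistribution_smul_eq (weight_hasTemperateGrowth _), density_spec,
      smulLeft_weight_neg]
  refine ⟨𝓕⁻ k, ?_⟩
  rw [← Lp.fourierInv_toTemperedDistribution_eq, hk]
  exact FourierTransform.fourierInv_fourier_eq _

/-! ### Zero extension and the space `H^s_*(Λ)` -/

/-- The interval `Λ = (-1, 1)`. -/
def Lam : Opens ℝ := ⟨Set.Ioo (-1) 1, isOpen_Ioo⟩

/-- A real test function on `Λ`, as a complex Schwartz function on `ℝ`. -/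
def testToSchwartz (φ : 𝓓(Lam, ℝ)) : 𝓢(ℝ, ℂ) :=
  HasCompactSupport.toSchwartzMap (f := fun x => (φ x : ℂ))
    (φ.hasCompactSupport.comp_left (g := Complex.ofReal) Complex.ofReal_zero)
    (Complex.ofRealCLM.contDiff.comp φ.contDiff)

/-- `w` is a zero extension to `ℝ` of the distribution `v` on `Λ`: it restricts to `v` on `Λ` and
vanishes outside the closure of `Λ`.  It is unique as soon as it lies in `H^s(ℝ)` with `s ≥ 0`
(see `IsZeroExtension.unique`): it is then a function, equal to `0` almost everywhere on
`ℝ \ Λ`. -/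
def IsZeroExtension (v : 𝓓'(Lam, ℂ)) (w : 𝓢'(ℝ, ℂ)) : Prop :=
  (∀ φ : 𝓓(Lam, ℝ), w (testToSchwartz φ) = v φ) ∧
    Distribution.IsVanishingOn w (Set.Icc (-1 : ℝ) 1)ᶜ

theorem IsZeroExtension.zero : IsZeroExtension 0 0 := ⟨fun _ => rfl, fun _ _ => rfl⟩

theorem IsZeroExtension.add {v v' : 𝓓'(Lam, ℂ)} {w w' : 𝓢'(ℝ, ℂ)} (h : IsZeroExtension v w)
    (h' : IsZeroExtension v' w') : IsZeroExtension (v + v') (w + w') :=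
  ⟨fun φ => congrArg₂ (· + ·) (h.1 φ) (h'.1 φ), fun u hu => by
    change w u + w' u = 0
    rw [h.2 u hu, h'.2 u hu, add_zero]⟩

theorem IsZeroExtension.smul (c : ℂ) {v : 𝓓'(Lam, ℂ)} {w : 𝓢'(ℝ, ℂ)} (h : IsZeroExtension v w) :
    IsZeroExtension (c • v) (c • w) :=
  ⟨fun φ => congrArg (c • ·) (h.1 φ), fun u hu => by
    change c • w u = 0
    rw [h.2 u hu, smul_zero]⟩

theorem IsZeroExtension.eq_zero (s : ℝ≥0) {w : 𝓢'(ℝ, ℂ)} (h : IsZeroExtension 0 w)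
    (hw : w ∈ sobolev s) : w = 0 := by
  obtain ⟨f, rfl⟩ := exists_L2_of_mem_sobolev s hw
  have hloc : LocallyIntegrable f (volume : Measure ℝ) :=
    (Lp.memLp f).locallyIntegrable (by norm_num)
  have h1 : ∀ᵐ x ∂(volume : Measure ℝ), x ∈ Set.Ioo (-1 : ℝ) 1 → f x = 0 := by
    refine isOpen_Ioo.ae_eq_zero_of_integral_contDiff_smul_eq_zero (hloc.locallyIntegrableOn _) ?_
    intro g hg hc hs
    have := h.1 ⟨g, hg, hc, hs⟩
    rw [Lp.toTemperedDistribution_apply] at this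
    simpa [testToSchwartz] using! this
  have h2 : ∀ᵐ x ∂(volume : Measure ℝ), x ∈ (Set.Icc (-1 : ℝ) 1)ᶜ → f x = 0 := by
    refine isClosed_Icc.isOpen_compl.ae_eq_zero_of_integral_contDiff_smul_eq_zero
      (hloc.locallyIntegrableOn _) ?_
    intro g hg hc hs
    have hg₁ : HasCompactSupport (Complex.ofRealCLM ∘ g) := hc.comp_left rfl
    have hg₂ : ContDiff ℝ ∞ (Complex.ofRealCLM ∘ g) := by fun_prop
    have hs' : tsupport (Complex.ofRealCLM ∘ g) ⊆ (Set.Icc (-1 : ℝ) 1)ᶜ :=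
      (tsupport_comp_subset rfl _).trans hs
    have := h.2 (hg₁.toSchwartzMap hg₂) hs'
    rw [Lp.toTemperedDistribution_apply] at this
    simpa using this
  have h3 : ∀ᵐ x ∂(volume : Measure ℝ), x ∉ ({-1, 1} : Set ℝ) :=
    measure_eq_zero_iff_ae_notMem.mp ((Set.toFinite _).measure_zero _)
  have h4 : f = 0 := by
    rw [Lp.eq_zero_iff_ae_eq_zero]
    filter_upwards [h1, h2, h3] with x a b c
    by_cases hx : x ∈ Set.Icc (-1 : ℝ) 1
    · refine a ⟨lt_of_le_of_ne hx.1 fun e => c ?_, lt_of_le_of_ne hx.2 fun e => c ?_⟩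
      · exact Or.inl e.symm
      · exact Or.inr e
    · exact b hx
  rw [h4, ← Lp.toTemperedDistributionCLM_apply, map_zero]

theorem IsZeroExtension.unique (s : ℝ≥0) {v : 𝓓'(Lam, ℂ)} {w w' : 𝓢'(ℝ, ℂ)}
    (h : IsZeroExtension v w) (hw : w ∈ sobolev s) (h' : IsZeroExtension v w')
    (hw' : w' ∈ sobolev s) : w = w' := by
  have h0 := h.add (h'.smul (-1))
  have e1 : v + (-1 : ℂ) • v = 0 := by module
  have e2 : w + (-1 : ℂ) • w' = w - w' := by module
  rw [e1, e2] at h0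
  exact sub_eq_zero.mp (h0.eq_zero s ((sobolev s).sub_mem hw hw'))

/-- `H^s_*(Λ)` as a set: the distributions on `Λ` whose zero extension lies in `H^s(ℝ)`. -/
def starSubmodule (s : ℝ≥0) : Submodule ℂ 𝓓'(Lam, ℂ) where
  carrier := {v | ∃ w ∈ sobolev s, IsZeroExtension v w}
  zero_mem' := ⟨0, (sobolev s).zero_mem, .zero⟩
  add_mem' := fun ⟨w, hw, h⟩ ⟨w', hw', h'⟩ => ⟨w + w', (sobolev s).add_mem hw hw', h.add h'⟩
  smul_mem' := fun c _ ⟨w, hw, h⟩ => ⟨c • w, (sobolev s).smul_mem c hw, h.smul c⟩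

/-- The space `H^s_*(Λ)`, `s ≥ 0`.  It is a type of its own, because it carries the norm
`‖·‖_{s,*}` and not the topology that it inherits from the space of distributions. -/
def HStar (s : ℝ≥0) : Type := starSubmodule s

namespace HStar

instance (s : ℝ≥0) : AddCommGroup (HStar s) := inferInstanceAs (AddCommGroup (starSubmodule s))

instance (s : ℝ≥0) : Module ℂ (HStar s) := inferInstanceAs (Module ℂ (starSubmodule s))

/-- An element of `H^s_*(Λ)`, as a distribution on `Λ`. -/
def toDistribution (s : ℝ≥0) : HStar s →ₗ[ℂ] 𝓓'(Lam, ℂ) := (starSubmodule s).subtype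

theorem exists_ext {s : ℝ≥0} (v : HStar s) :
    ∃ w : sobolev s, IsZeroExtension (toDistribution s v) w := by
  obtain ⟨w, hw, h⟩ := v.2
  exact ⟨⟨w, hw⟩, h⟩

/-- The zero extension `v ↦ ṽ` from `H^s_*(Λ)` to `H^s(ℝ)`. -/
def zeroExt (s : ℝ≥0) : HStar s →ₗ[ℂ] sobolev s where
  toFun v := (exists_ext v).choose
  map_add' v v' := by
    refine Subtype.ext (IsZeroExtension.unique s (exists_ext (v + v')).choose_spec
      (Subtype.prop _) ?_ (Subtype.prop _))
    rw [map_add]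
    exact (exists_ext v).choose_spec.add (exists_ext v').choose_spec
  map_smul' c v := by
    refine Subtype.ext (IsZeroExtension.unique s (exists_ext (c • v)).choose_spec
      (Subtype.prop _) ?_ (Subtype.prop _))
    rw [map_smul]
    exact (exists_ext v).choose_spec.smul c

theorem zeroExt_spec {s : ℝ≥0} (v : HStar s) :
    IsZeroExtension (toDistribution s v) (zeroExt s v) := (exists_ext v).choose_spec

theorem zeroExt_injective (s : ℝ≥0) : Function.Injective (zeroExt s) := by
  refine (injective_iff_map_eq_zero _).mpr fun v hv => ?_
  refine Subtype.ext (ContinuousLinearMap.ext fun φ => ?_)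
  have h := (zeroExt_spec v).1 φ
  rw [hv] at h
  exact h.symm

instance (s : ℝ≥0) : NormedAddCommGroup (HStar s) :=
  NormedAddCommGroup.induced (HStar s) (Lp ℂ 2 (volume : Measure ℝ)) (density s ∘ₗ zeroExt s)
    ((density_injective s).comp (zeroExt_injective s))

instance (s : ℝ≥0) : NormedSpace ℂ (HStar s) :=
  NormedSpace.induced ℂ (HStar s) (Lp ℂ 2 (volume : Measure ℝ)) (density s ∘ₗ zeroExt s)

/-- The norm of `H^s_*(Λ)` is `‖v‖_{s,*} = ‖ṽ‖_{s,ℝ}`. -/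
theorem norm_eq {s : ℝ≥0} (v : HStar s) : ‖v‖ = sobolevNorm s (zeroExt s v) := rfl

end HStar

/-- The function `f ∈ L²(Λ)` represents the distribution `v` on `Λ`: `⟨v, φ⟩ = ∫_Λ φ f`. -/
def Represents (f : Lp ℂ 2 (volume.restrict (Lam : Set ℝ))) (v : 𝓓'(Lam, ℂ)) : Prop :=
  ∀ φ : 𝓓(Lam, ℝ), v φ = ∫ x in (Lam : Set ℝ), φ x • f x

end FracSobolev

end

noncomputable section

namespace FracSobolev

/-! The map `v ↦ g = (1 + |ξ|²)^{s/2} 𝓕 ṽ` is an isometry into `L²(ℝ)`, and `ṽ` is recovered as `𝓕⁻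
(weight (-s) · g)`. The embedding is therefore this isometry followed by multiplication by `weight
(-s)`, then `𝓕⁻`, then restriction to `Λ`; it suffices that the last three compose to a compact
operator.

For `s > 0` the weight decays at infinity, so its truncations to `|η| ≤ n` converge to it uniformly,
and the corresponding operators converge in norm. Since norm limits of compact operators are
compact, only cut-off frequencies remain (`isCompactOperator_band`). There the unit ball of `L²`
yields uniformly bounded, uniformly Lipschitz functions, to which Arzelà–Ascoli applies on `[-1,
1]`; uniform convergence implies convergence in `L²(Λ)`. -/

/-- The inverse Fourier transform of an integrable function in `L²` is given by the integral. -/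
theorem fourierInv_ae_eq_of_integrable (f : Lp ℂ 2 (volume : Measure ℝ))
    (hf : Integrable f (volume : Measure ℝ)) :
    (𝓕⁻ f : Lp ℂ 2 (volume : Measure ℝ)) =ᵐ[volume] 𝓕⁻ (f : ℝ → ℂ) := by
  have hcont : Continuous (𝓕⁻ (f : ℝ → ℂ)) := by
    rw [← Real.Lp.fourierTransformInv_toLp (memLp_one_iff_integrable.mpr hf)]
    exact BoundedContinuousFunction.continuous _
  refine ae_eq_of_integral_contDiff_smul_eq ((Lp.memLp _).locallyIntegrable (by norm_num))
    hcont.locallyIntegrable fun g hg hc => ?_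
  have hg₁ : HasCompactSupport (Complex.ofRealCLM ∘ g) := hc.comp_left rfl
  have hg₂ : ContDiff ℝ ∞ (Complex.ofRealCLM ∘ g) := by fun_prop
  let φ : 𝓢(ℝ, ℂ) := hg₁.toSchwartzMap hg₂
  have h1 : ((𝓕⁻ f : Lp ℂ 2 (volume : Measure ℝ)) : 𝓢'(ℝ, ℂ)) φ = (f : 𝓢'(ℝ, ℂ)) (𝓕⁻ φ) := by
    rw [← Lp.fourierInv_toTemperedDistribution_eq, TemperedDistribution.fourierInv_apply]
  rw [Lp.toTemperedDistribution_apply, Lp.toTemperedDistribution_apply] at h1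
  have h2 : ∫ x, (𝓕⁻ φ : 𝓢(ℝ, ℂ)) x • f x = ∫ x, φ x • 𝓕⁻ (f : ℝ → ℂ) x := by
    -- With the form `-innerₗ ℝ` the kernel is `e^{2πiηx}`, that of `𝓕⁻`. The form is symmetric, so
    -- Fubini moves `𝓕⁻` from `φ` to `f`.
    have h3 := VectorFourier.integral_fourierIntegral_smul_eq_flip (L := -innerₗ ℝ)
      (f := φ) (g := f) (μ := volume) (ν := volume)
      Real.continuous_fourierChar (by simpa using! continuous_inner.neg) φ.integrable hf
    have h4 : (-innerₗ ℝ).flip = -innerₗ ℝ := by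
      ext
      simp
    rw [h4] at h3
    simpa [SchwartzMap.fourierInv_coe] using! h3
  rw [h2] at h1
  simpa [φ] using! h1

/-! ### Compactness for cut-off frequencies. -/

/-- The indicator function of `[-n, n]`. -/
def band (n : ℕ) : ℝ → ℂ := (Set.Icc (-n : ℝ) n).indicator fun _ => 1

theorem memLp_band (n : ℕ) (p : ℝ≥0∞) : MemLp (band n) p (volume : Measure ℝ) :=
  memLp_indicator_const p measurableSet_Icc 1 (Or.inr (by simp))

/-- Multiplication by a bounded function on `L²(ℝ)`. -/
def mulL : Lp ℂ ⊤ (volume : Measure ℝ) →L[ℂ]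
    Lp ℂ 2 (volume : Measure ℝ) →L[ℂ] Lp ℂ 2 (volume : Measure ℝ) :=
  (ContinuousLinearMap.lsmul ℂ ℂ).holderL volume ⊤ 2 2

theorem mulL_apply (m : Lp ℂ ⊤ (volume : Measure ℝ)) (g : Lp ℂ 2 (volume : Measure ℝ)) :
    mulL m g = (m • g : Lp ℂ 2 (volume : Measure ℝ)) := rfl

/-- The inverse Fourier transform on `L²(ℝ)`, followed by the restriction to `Λ`. -/
def restrictFourierInv : Lp ℂ 2 (volume : Measure ℝ) →L[ℂ] Lp ℂ 2 (volume.restrict (Lam : Set ℝ)) :=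
  (LpToLpRestrictCLM ℝ ℂ ℂ volume 2 (Lam : Set ℝ)) ∘L
    ((Lp.fourierTransformₗᵢ ℝ ℂ).symm.toContinuousLinearEquiv : _ →L[ℂ] _)

theorem restrictFourierInv_ae (g : Lp ℂ 2 (volume : Measure ℝ)) :
    restrictFourierInv g =ᵐ[volume.restrict (Lam : Set ℝ)]
      (𝓕⁻ g : Lp ℂ 2 (volume : Measure ℝ)) :=
  LpToLpRestrictCLM_coeFn ℂ (Lam : Set ℝ) _

theorem norm_exp_sub_exp_le (a b : ℝ) :
    ‖Complex.exp (a * Complex.I) - Complex.exp (b * Complex.I)‖ ≤ |a - b| := by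
  have h : Complex.exp (a * Complex.I) - Complex.exp (b * Complex.I) =
      Complex.exp (b * Complex.I) * (Complex.exp (Complex.I * ((a - b : ℝ) : ℂ)) - 1) := by
    rw [mul_sub, ← Complex.exp_add, mul_one]
    push_cast
    ring_nf
  rw [h, norm_mul, Complex.norm_exp_ofReal_mul_I, one_mul]
  exact Real.norm_exp_I_mul_ofReal_sub_one_le

/-- For `|η| ≤ R` the kernel `e^{2πiηx}` is `2πR`-Lipschitz in `x`. This gives the equicontinuity
for Arzelà–Ascoli. -/
theorem norm_fourierInv_sub_le {f : ℝ → ℂ} (hf : Integrable f) {R : ℝ}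
    (hR : ∀ᵐ η, f η ≠ 0 → |η| ≤ R) (x y : ℝ) :
    ‖𝓕⁻ f x - 𝓕⁻ f y‖ ≤ 2 * Real.pi * R * |x - y| * ∫ η, ‖f η‖ := by
  have hint : ∀ z : ℝ, Integrable fun η : ℝ =>
      Complex.exp (↑(2 * Real.pi * inner ℝ η z) * Complex.I) • f η := by
    intro z
    have hc : Continuous fun η : ℝ =>
        Complex.exp (↑(2 * Real.pi * inner ℝ η z) * Complex.I) := by fun_prop
    refine hf.bdd_smul 1 hc.aestronglyMeasurable (.of_forall fun η => ?_)
    rw [Complex.norm_exp_ofReal_mul_I]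
  rw [Real.fourierInv_eq', Real.fourierInv_eq', ← integral_sub (hint x) (hint y),
    ← integral_const_mul]
  refine norm_integral_le_of_norm_le (hf.norm.const_mul _) ?_
  filter_upwards [hR] with η hη
  rw [← sub_smul, norm_smul]
  by_cases h0 : f η = 0
  · simp [h0]
  refine mul_le_mul_of_nonneg_right ((norm_exp_sub_exp_le _ _).trans ?_) (norm_nonneg _)
  have : 2 * Real.pi * inner ℝ η x - 2 * Real.pi * inner ℝ η y = 2 * Real.pi * η * (x - y) := by
    simp only [RCLike.inner_apply, conj_trivial]
    ring
  rw [this, abs_mul, abs_mul, abs_of_pos Real.two_pi_pos]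
  gcongr
  exact hη h0

/-- The band-limited part of a function in `L²(ℝ)`, as an integrable function. -/
def bandL1 (n : ℕ) (g : Lp ℂ 2 (volume : Measure ℝ)) : Lp ℂ 1 (volume : Measure ℝ) :=
  (memLp_band n 2).toLp _ • g

theorem bandL1_ae (n : ℕ) (g : Lp ℂ 2 (volume : Measure ℝ)) :
    bandL1 n g =ᵐ[volume] fun η => band n η * g η := by
  filter_upwards [Lp.coeFn_lpSMul (r := 1) ((memLp_band n 2).toLp _) g,
    (memLp_band n 2).coeFn_toLp] with η h1 h2
  rw [bandL1, h1, Pi.smul_apply', h2, smul_eq_mul]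

theorem mulL_band_ae (n : ℕ) (g : Lp ℂ 2 (volume : Measure ℝ)) :
    mulL ((memLp_band n ⊤).toLp _) g =ᵐ[volume] fun η => band n η * g η := by
  rw [mulL_apply]
  filter_upwards [Lp.coeFn_lpSMul (r := 2) ((memLp_band n ⊤).toLp _) g,
    (memLp_band n ⊤).coeFn_toLp] with η h1 h2
  rw [h1, Pi.smul_apply', h2, smul_eq_mul]

/-- The cut-off makes `g` integrable, which supplies a bounded continuous representative, accessible
to sup-norm estimates. -/
theorem restrictFourierInv_mulL_band_ae (n : ℕ) (g : Lp ℂ 2 (volume : Measure ℝ)) :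
    restrictFourierInv (mulL ((memLp_band n ⊤).toLp _) g) =ᵐ[volume.restrict (Lam : Set ℝ)]
      Real.Lp.fourierTransformInvCLM ℝ ℂ (bandL1 n g) := by
  have h : mulL ((memLp_band n ⊤).toLp _) g =ᵐ[volume] bandL1 n g :=
    (mulL_band_ae n g).trans (bandL1_ae n g).symm
  refine (restrictFourierInv_ae _).trans (ae_restrict_of_ae ?_)
  filter_upwards [fourierInv_ae_eq_of_integrable (mulL ((memLp_band n ⊤).toLp _) g)
    ((L1.integrable_coeFn _).congr h.symm)] with x hx
  rw [hx, Real.Lp.fourierTransformInvCLM_apply, Real.Lp.fourierTransformInv_apply]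
  exact Real.fourierInv_congr_ae h x

theorem isCompactOperator_band (n : ℕ) :
    IsCompactOperator (restrictFourierInv ∘L mulL ((memLp_band n ⊤).toLp _)) := by
  -- The closed interval is used because Arzelà–Ascoli needs a compact domain.
  let F : Lp ℂ 2 (volume : Measure ℝ) → BoundedContinuousFunction (Set.Icc (-1 : ℝ) 1) ℂ :=
    fun g => (Real.Lp.fourierTransformInvCLM ℝ ℂ (bandL1 n g)).compContinuous
      ⟨Subtype.val, continuous_subtype_val⟩
  -- By Cauchy–Schwarz, `b` bounds the `L¹` norm of the cut-off of any `g` in the unit ball.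
  let b : ℝ := ‖(memLp_band n 2).toLp (band n)‖
  have hnorm : ∀ g ∈ Metric.ball (0 : Lp ℂ 2 (volume : Measure ℝ)) 1, ‖bandL1 n g‖ ≤ b := by
    intro g hg
    rw [mem_ball_zero_iff] at hg
    exact (Lp.norm_smul_le _ _).trans (mul_le_of_le_one_right (norm_nonneg _) hg.le)
  let M : ℝ := ‖Real.Lp.fourierTransformInvCLM ℝ ℂ‖ * b
  let C : ℝ := 2 * Real.pi * n * b
  have hcpt : IsCompact (closure (F '' Metric.ball 0 1)) := by
    refine BoundedContinuousFunction.arzela_ascoli (Metric.closedBall 0 M)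
      (isCompact_closedBall _ _) _ ?_ ?_
    · rintro _ x ⟨g, hg, rfl⟩
      rw [mem_closedBall_zero_iff]
      refine (BoundedContinuousFunction.norm_coe_le_norm _ (x : ℝ)).trans
        (((Real.Lp.fourierTransformInvCLM ℝ ℂ).le_opNorm _).trans ?_)
      exact mul_le_mul_of_nonneg_left (hnorm g hg) (norm_nonneg _)
    · refine LipschitzWith.uniformEquicontinuous _ C.toNNReal ?_ |>.equicontinuous
      rintro ⟨_, g, hg, rfl⟩
      refine LipschitzWith.of_dist_le' fun x y => ?_
      rw [dist_eq_norm, Subtype.dist_eq, Real.dist_eq]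
      change ‖Real.Lp.fourierTransformInvCLM ℝ ℂ (bandL1 n g) x -
        Real.Lp.fourierTransformInvCLM ℝ ℂ (bandL1 n g) y‖ ≤ _
      rw [Real.Lp.fourierTransformInvCLM_apply, Real.Lp.fourierTransformInv_apply,
        Real.Lp.fourierTransformInv_apply]
      refine (norm_fourierInv_sub_le (R := n) (L1.integrable_coeFn _) ?_ _ _).trans ?_
      · filter_upwards [bandL1_ae n g] with η h1 h2
        rw [h1] at h2
        have h3 : band n η ≠ 0 := left_ne_zero_of_mul h2
        have h4 : η ∈ Set.Icc (-n : ℝ) n := Set.mem_of_indicator_ne_zero h3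
        exact abs_le.mpr h4
      · rw [← L1.norm_eq_integral_norm]
        have := hnorm g hg
        calc _ ≤ 2 * Real.pi * n * |(x : ℝ) - y| * b := by gcongr
          _ = _ := by ring
  have : IsFiniteMeasure (volume.restrict (Lam : Set ℝ)) :=
    inferInstanceAs (IsFiniteMeasure (volume.restrict (Set.Ioo (-1 : ℝ) 1)))
  -- Clamping to `[-1, 1]` extends functions to `ℝ` without changing them on `Λ`; `Λ` has finite
  -- measure, so `Φ` is continuous from sup norm to `L²`.
  let Φ : BoundedContinuousFunction (Set.Icc (-1 : ℝ) 1) ℂ →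
      Lp ℂ 2 (volume.restrict (Lam : Set ℝ)) := fun f =>
    BoundedContinuousFunction.toLp 2 (volume.restrict (Lam : Set ℝ)) ℂ
      (BoundedContinuousFunction.compContinuousCLM ℂ ℂ
        ⟨Set.projIcc (-1) 1 (by norm_num), continuous_projIcc⟩ f)
  have hΦ : Continuous Φ := by
    fun_prop
  refine (isCompactOperator_iff_image_ball_subset_compact _ one_pos).mpr
    ⟨Φ '' closure (F '' Metric.ball 0 1), hcpt.image hΦ, ?_⟩
  rintro _ ⟨g, hg, rfl⟩
  refine ⟨F g, subset_closure ⟨g, hg, rfl⟩, ?_⟩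
  refine Lp.ext ?_
  refine (BoundedContinuousFunction.coeFn_toLp _ _ _ _).trans
    (.trans ?_ (restrictFourierInv_mulL_band_ae n g).symm)
  filter_upwards [ae_restrict_mem measurableSet_Ioo] with x hx
  rw [BoundedContinuousFunction.compContinuousCLM_apply,
    BoundedContinuousFunction.coe_compContinuous, Function.comp_apply, ContinuousMap.coe_mk,
    Set.projIcc_of_mem _ (Set.Ioo_subset_Icc_self hx)]
  rfl

/-! ### From cut-off frequencies to the Sobolev weight. -/

theorem memLp_weight_neg (s : ℝ≥0) :
    MemLp (fun η : ℝ => (weight (-s) η : ℂ)) ⊤ (volume : Measure ℝ) := by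
  refine memLp_top_of_bound
    (weight_hasTemperateGrowth _).1.continuous.aestronglyMeasurable 1 (.of_forall fun η => ?_)
  have h1 : 0 ≤ weight (-s) η := by unfold weight; positivity
  rw [Complex.norm_real, Real.norm_of_nonneg h1]
  exact Real.rpow_le_one_of_one_le_of_nonpos (by nlinarith [sq_nonneg (2 * Real.pi * η)])
    (by linarith [s.coe_nonneg])

/-- Strict positivity of `s` enters the compactness proof through this decay. -/
theorem tendsto_weight_neg {s : ℝ} (hs : 0 < s) :
    Filter.Tendsto (fun n : ℕ => weight (-s) n) Filter.atTop (nhds 0) := by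
  have h1 : Filter.Tendsto (fun n : ℕ => 1 + (2 * Real.pi * n) ^ 2) Filter.atTop Filter.atTop := by
    refine Filter.tendsto_atTop_add_const_left _ _ ((Filter.tendsto_pow_atTop two_ne_zero).comp ?_)
    exact tendsto_natCast_atTop_atTop.const_mul_atTop Real.two_pi_pos
  have h2 := (tendsto_rpow_neg_atTop (half_pos hs)).comp h1
  refine h2.congr fun n => ?_
  simp [weight, neg_div]

theorem weight_neg_le {s : ℝ} (hs : 0 ≤ s) {a η : ℝ} (ha : 0 ≤ a) (h : a ≤ |η|) :
    weight (-s) η ≤ weight (-s) a := by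
  refine Real.rpow_le_rpow_of_nonpos (by positivity) ?_ (by linarith)
  rw [mul_pow, mul_pow _ η, ← sq_abs η]
  gcongr

theorem isCompactOperator_restrictFourierInv_mulL_weight (s : ℝ≥0) (hs : 0 < s) :
    IsCompactOperator (restrictFourierInv ∘L mulL ((memLp_weight_neg s).toLp _)) := by
  let m := (memLp_weight_neg s).toLp _
  have hprod (n : ℕ) : MemLp (fun η => band n η * (weight (-s) η : ℂ)) ⊤ (volume : Measure ℝ) :=
    (memLp_weight_neg s).mul (memLp_band n ⊤)
  have hlim : Filter.Tendsto (fun n : ℕ => (hprod n).toLp _) Filter.atTop (nhds m) := by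
    rw [tendsto_iff_norm_sub_tendsto_zero]
    refine squeeze_zero (fun _ => norm_nonneg _) (fun n => ?_)
      (tendsto_weight_neg (s := s) (by exact_mod_cast hs))
    have hw : ∀ η, 0 ≤ weight (-s) η := fun η => by unfold weight; positivity
    rw [← MemLp.toLp_sub, Lp.norm_toLp, eLpNorm_exponent_top]
    refine ENNReal.toReal_le_of_le_ofReal (hw n)
      (eLpNormEssSup_le_of_ae_bound (.of_forall fun η => ?_))
    simp only [Pi.sub_apply, band, Set.indicator_apply]
    -- Inside the band the difference is zero; outside, `|η| > n` and monotonicity bounds it by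
    -- `weight (-s) n`.
    split_ifs with h
    · simpa using hw n
    · rw [zero_mul, zero_sub, norm_neg, Complex.norm_real, Real.norm_of_nonneg (hw η)]
      refine weight_neg_le s.coe_nonneg n.cast_nonneg ?_
      rw [Set.mem_Icc, ← abs_le, not_le] at h
      exact h.le
  refine isCompactOperator_of_tendsto (l := Filter.atTop)
    (F := fun n : ℕ => restrictFourierInv ∘L mulL ((hprod n).toLp _)) ?_ (.of_forall fun n => ?_)
  · exact ((ContinuousLinearMap.compL ℂ _ _ _ restrictFourierInv).continuous.tendsto _).comp
      ((mulL.continuous.tendsto _).comp hlim)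
  -- Splitting off the cut-off writes the operator as a compact one after a bounded one.
  · have h : mulL ((hprod n).toLp _) = mulL ((memLp_band n ⊤).toLp _) ∘L mulL m := by
      ext1 g
      refine Lp.ext ?_
      rw [ContinuousLinearMap.comp_apply]
      refine .trans ?_ (mulL_band_ae n _).symm
      rw [mulL_apply, mulL_apply]
      filter_upwards [Lp.coeFn_lpSMul (r := 2) ((hprod n).toLp _) g, (hprod n).coeFn_toLp,
        Lp.coeFn_lpSMul (r := 2) m g, (memLp_weight_neg s).coeFn_toLp] with η h1 h2 h3 h4
      rw [h1, h3, Pi.smul_apply', Pi.smul_apply', h2, h4, smul_eq_mul, smul_eq_mul, mul_assoc]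
    rw [h]
    exact (isCompactOperator_band n).comp_clm (mulL m)

/-! ### The embedding into `L²(Λ)`. -/

namespace HStar

/-- The isometric embedding `v ↦ (1 + |ξ|²)^{s/2} 𝓕 ṽ` of `H^s_*(Λ)` into `L²(ℝ)`. -/
def densityL (s : ℝ≥0) : HStar s →L[ℂ] Lp ℂ 2 (volume : Measure ℝ) :=
  (density s ∘ₗ zeroExt s).mkContinuous 1 fun v => by rw [one_mul]; exact le_rfl

/-- The zero extension of `v ∈ H^s_*(Λ)`, as a function in `L²(ℝ)`. -/
theorem toTemperedDistribution_fourierInv (s : ℝ≥0) (v : HStar s) :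
    ((𝓕⁻ (mulL ((memLp_weight_neg s).toLp _) (densityL s v)) :
      Lp ℂ 2 (volume : Measure ℝ)) : 𝓢'(ℝ, ℂ)) = zeroExt s v := by
  rw [← Lp.fourierInv_toTemperedDistribution_eq, mulL_apply,
    Lp.toTemperedDistribution_smul_eq (weight_hasTemperateGrowth _)]
  change 𝓕⁻ (smulLeftCLM ℂ _ (density s (zeroExt s v) : 𝓢'(ℝ, ℂ))) = _
  rw [density_spec, smulLeft_weight_neg]
  exact FourierTransform.fourierInv_fourier_eq _

/-- The embedding of `H^s_*(Λ)` into `L²(Λ)`. -/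
def toL2 (s : ℝ≥0) : HStar s →L[ℂ] Lp ℂ 2 (volume.restrict (Lam : Set ℝ)) :=
  (restrictFourierInv ∘L mulL ((memLp_weight_neg s).toLp _)) ∘L densityL s

theorem represents_toL2 (s : ℝ≥0) (v : HStar s) :
    Represents (toL2 s v) (toDistribution s v) := by
  intro φ
  rw [← (zeroExt_spec v).1 φ, ← toTemperedDistribution_fourierInv, Lp.toTemperedDistribution_apply]
  set f : Lp ℂ 2 (volume : Measure ℝ) :=
    𝓕⁻ (mulL ((memLp_weight_neg s).toLp _) (densityL s v))
  have h1 : ∫ x in (Lam : Set ℝ), φ x • toL2 s v x = ∫ x in (Lam : Set ℝ), φ x • f x := by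
    refine integral_congr_ae ?_
    filter_upwards [restrictFourierInv_ae (mulL ((memLp_weight_neg s).toLp _) (densityL s v))]
      with x hx
    rw [toL2, ContinuousLinearMap.comp_apply, ContinuousLinearMap.comp_apply, hx]
  -- The test function is supported in `Λ`, so integrals over `Λ` and over `ℝ` agree.
  rw [h1, setIntegral_eq_integral_of_forall_compl_eq_zero]
  · rfl
  · intro x hx
    rw [image_eq_zero_of_notMem_tsupport fun h => hx (φ.tsupport_subset h), zero_smul]

/-- A function determines the distribution it represents. -/
theorem toL2_injective (s : ℝ≥0) : Function.Injective (toL2 s) := by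
  intro v w h
  refine Subtype.ext (ContinuousLinearMap.ext fun φ => ?_)
  have hv := represents_toL2 s v φ
  rw [h] at hv
  exact hv.trans (represents_toL2 s w φ).symm

theorem isCompactOperator_toL2 (s : ℝ≥0) (hs : 0 < s) : IsCompactOperator (toL2 s) :=
  (isCompactOperator_restrictFourierInv_mulL_weight s hs).comp_clm (densityL s)

end HStar

end FracSobolev

end

theorem mainTheorem9 (s : ℝ≥0) (hs : 0 < s) :
    ∃ ι : FracSobolev.HStar s →L[ℂ] Lp ℂ 2 (volume.restrict (FracSobolev.Lam : Set ℝ)),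
      (∀ v : FracSobolev.HStar s,
        FracSobolev.Represents (ι v) (FracSobolev.HStar.toDistribution s v)) ∧
      Function.Injective ι ∧ IsCompactOperator ι :=
  ⟨FracSobolev.HStar.toL2 s, FracSobolev.HStar.represents_toL2 s,
    FracSobolev.HStar.toL2_injective s, FracSobolev.HStar.isCompactOperator_toL2 s hs⟩
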